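/- **Ideals generated by self-loops are Hopf ideals.** *Local QFT.* Let $\mathcal Q$ be a local QFT, given by: a set of particle types with an involution $a\mapsto\bar a$ (antiparticle); a residue set $\mathcal R=\mathcal R^{[0]}\amalg\mathcal R^{[1]}$, where a residue is a finite multiset of particle types (its half-edges), vertex residues (elements of $\mathcal R^{[0]}$) are non-empty, and edge residues (elements of $\mathcal R^{[1]}$) have the form $\{a,\bar a\}$; a weight $\omega\colon\mathcal R\to\mathbb N_0$; and a spacetime dimension $d\in\mathbb N_0$. *Feynman graphs.* $\mathscr G$ denotes the set of isomorphism classes of connected one-particle irreducible finite graphs with labelled half-edges which have at least one internal edge and at least one external leg, and whose vertices and internal edges are of types in $\mathcal R^{[0]}$ and $\mathcal R^{[1]}$. We write $\Gamma^{[0]}$, $\Gamma^{[1]}$ for the sets of vertices and of internal edges. The residue $\operatorname{res}\Gamma$ is the multiset of types of the external legs. The superficial degree of divergence is $$\omega(\Gamma)=d\,b_1(\Gamma)+\sum_{v\in\Gamma^{[0]}}\omega(v)-\sum_{e\in\Gamma^{[1]}}\omega(e),$$ with $b_1$ the first Betti number, and $\Gamma$ is divergent if $\omega(\Gamma)\ge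 0$. A subgraph $\gamma\subseteq\Gamma$ is given by a set of internal edges of $\Gamma$; its vertices are the endpoints of these edges, and all remaining half-edges of $\Gamma$ at these vertices are its external legs. *Algebra and structure maps.* For a set $G\subseteq\mathscr G$ of graphs and a set $A\subseteq\mathscr G$ of admissible subgraph components, let $H_G$ be the commutative $\mathbb Q$-algebra of polynomials in the elements of $G$ (the vector space spanned by finite disjoint unions of graphs in $G$, with disjoint union as product and the empty graph $\mathbb I$ as unit). Its coproduct $\Delta$ and coidentity $\hat{\mathbb I}$ are the algebra homomorphisms with $$\Delta(\Gamma)=\mathbb I\otimes\Gamma+\Gamma\otimes\mathbb I+\sum_{\gamma}\gamma\otimes\Gamma/\gamma,\qquad \hat{\mathbb I}(\Gamma)=0\qquad(\Gamma\in G),$$ and the antipode $S$ is the algebra homomorphism given recursively by $$S(\Gamma)=-\Gamma-\sum_{\gamma}S(\gamma)\,\Gamma/\gamma\qquad(\Gamma\in G).$$ Both sums run over the non-empty proper subgraphs $\gamma\subsetneq\Gamma$ all of whose connected components lie in $A$. Here $\Gamma/\gamma$ arises by shrinking each connected component $\gamma_i$ of $\gamma$ to its residue: to a vertex, or, if $\operatorname{res}\gamma_i\in\mathcal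 R^{[1]}$, to a single edge. Graphs outside $G$ are set to zero. *Renormalization Hopf algebra.* Let $\mathcal H$ be $H_G$ with these maps in one of the following cases. 1. Every divergent graph of $\mathcal Q$ has its residue in $\mathcal R$; $G=\mathscr G$, and $A$ is the set of all divergent graphs. 2. $\mathcal Q$ is arbitrary; $G$ is the set of graphs in $\mathscr G$ that neither are nor contain a connected divergent 1PI subgraph with residue not in $\mathcal R$, and $A$ is the set of all divergent graphs. 3. $\mathcal Q$ is arbitrary; $G=\mathscr G$, and $A$ is the set of divergent graphs with residue in $\mathcal R$. 4. $\mathcal Q$ is replaced by a local QFT $\mathcal Q'$ with the same particle types, the same involution and the same $d$, obtained by adding missing residues, each added residue having the weight $\omega(\Gamma)$ of some divergent graph $\Gamma$ of $\mathcal Q'$ with this residue, such that every divergent graph of $\mathcal Q'$ has its residue in the residue set of $\mathcal Q'$; then $G$ and $A$ are as in case 1 for $\mathcal Q'$. *Claim.* Let $\mathscr S_S\subseteq G$ be the set of all graphs which are or contain a self-loop ("rose"), i.e. $$\mathscr S_S=\left\{\Gamma\in G\;\middle|\;\exists\,\gamma\subseteq\Gamma:\ \#\gamma^{[0]}=1,\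 \#\gamma^{[1]}\ge 1\right\},$$ and let $\mathfrak i_S$ be the ideal of $\mathcal H$ generated by $\mathscr S_S$. Then, in each of the four cases, $\mathfrak i_S$ is a Hopf ideal, i.e. $$\Delta(\mathfrak i_S)\subseteq\mathfrak i_S\otimes\mathcal H+\mathcal H\otimes\mathfrak i_S,\qquad \hat{\mathbb I}(\mathfrak i_S)=0,\qquad S(\mathfrak i_S)\subseteq\mathfrak i_S .$$ -/

import Mathlib

open scoped TensorProduct

universe u

/-- A local quantum field theory, given by its weighted residue set. `F` is the set of particle types
(types of half-edges) and `conj` sends a particle to its antiparticle. A residue is recorded as the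
multiset of its half-edges. An edge residue consists of two mutually conjugate half-edges. `weight` is
the weight of the residues (its values outside the residue set are never used) and `dim` is the
dimension of spacetime. -/
structure LocalQFT (F : Type u) where
  conj : F → F
  conj_conj : ∀ a, conj (conj a) = a
  vertexRes : Set (Multiset F)
  edgeRes : Set (Multiset F)
  zero_notMem : (0 : Multiset F) ∉ vertexRes
  edge_pair : ∀ r ∈ edgeRes, ∃ a, r = {a, conj a}
  disjoint_res : Disjoint vertexRes edgeRes
  weight : Multiset F → ℕ
  dim : ℕ

/-- The residue set of a local QFT. -/
def LocalQFT.residues {F : Type u} (Q : LocalQFT F) : Set (Multiset F) := Q.vertexRes ∪ Q.edgeRes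

/-- A finite graph with external legs, whose half-edges are labelled by particle types. The vertices
are the classes of `vtx`. The internal edges are the two-element classes of `edg`, the external legs
the one-element classes of `edg` (in the diagrams of a QFT, there are no bigger ones, see
`LocalQFT.graphs`). Every vertex carries at least one half-edge. -/
structure Diagram (F : Type u) where
  Half : Type
  fin : Fintype Half
  vtx : Setoid Half
  edg : Setoid Half
  field : Half → F

attribute [instance] Diagram.fin

namespace Diagram

variable {F : Type u}

/-- Isomorphism of diagrams: a bijection of the half-edges preserving vertices, edges, and types. -/
def Iso (Γ Γ' : Diagram F) : Prop :=
  ∃ e : Γ.Half ≃ Γ'.Half, (∀ h k, Γ.vtx h k ↔ Γ'.vtx (e h) (e k)) ∧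
    (∀ h k, Γ.edg h k ↔ Γ'.edg (e h) (e k)) ∧ ∀ h, Γ'.field (e h) = Γ.field h

theorem iso_equivalence : Equivalence (Iso (F := F)) where
  refl Γ := ⟨Equiv.refl _, by simp⟩
  symm := by
    rintro Γ Γ' ⟨e, h1, h2, h3⟩
    refine ⟨e.symm, fun h k => ?_, fun h k => ?_, fun h => ?_⟩
    · rw [h1]; simp
    · rw [h2]; simp
    · rw [← h3]; simp
  trans := by
    rintro Γ Γ' Γ'' ⟨e, h1, h2, h3⟩ ⟨e', h1', h2', h3'⟩
    refine ⟨e.trans e', fun h k => ?_, fun h k => ?_, fun h => ?_⟩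
    · rw [h1, h1']; simp
    · rw [h2, h2']; simp
    · rw [← h3, ← h3']; simp

open Classical in
/-- The half-edges that belong to internal edges. -/
noncomputable def internal (Γ : Diagram F) : Finset Γ.Half :=
  Finset.univ.filter fun h => ∃ k, k ≠ h ∧ Γ.edg h k

open Classical in
/-- The multiset of particle types occurring in a class of half-edges. -/
noncomputable def fieldsAt (Γ : Diagram F) (s : Setoid Γ.Half) (c : Quotient s) : Multiset F :=
  (Finset.univ.filter fun h : Γ.Half => Quotient.mk s h = c).val.map Γ.field

open Classical in
/-- The vertices. -/
noncomputable def vertices (Γ : Diagram F) : Finset (Quotient Γ.vtx) :=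
  Finset.univ.image (Quotient.mk Γ.vtx)

open Classical in
/-- The internal edges. -/
noncomputable def edges (Γ : Diagram F) : Finset (Quotient Γ.edg) :=
  Γ.internal.image (Quotient.mk Γ.edg)

open Classical in
/-- The residue of a connected diagram, obtained by shrinking all internal edges to a single vertex,
i.e. the multiset of the types of the external legs. -/
noncomputable def residue (Γ : Diagram F) : Multiset F :=
  (Finset.univ.filter fun h => h ∉ Γ.internal).val.map Γ.field

/-- The equivalence relation that joins two half-edges iff they form an edge inside `S`. -/
def edgesOn (Γ : Diagram F) (S : Set Γ.Half) : Setoid Γ.Half where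
  r h k := h = k ∨ (h ∈ S ∧ k ∈ S ∧ Γ.edg h k)
  iseqv :=
    { refl := fun _ => Or.inl rfl
      symm := by
        rintro h k (rfl | ⟨hh, hk, e⟩)
        · exact Or.inl rfl
        · exact Or.inr ⟨hk, hh, Γ.edg.symm e⟩
      trans := by
        rintro h k l (rfl | ⟨hh, hk, e⟩) (rfl | ⟨_, hl, e'⟩)
        · exact Or.inl rfl
        · exact Or.inr ⟨‹_›, hl, e'⟩
        · exact Or.inr ⟨hh, hk, e⟩
        · exact Or.inr ⟨hh, hl, Γ.edg.trans e e'⟩ }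

/-- One-particle irreducible: connected, and still connected after cutting any internal edge. -/
def IsOnePI (Γ : Diagram F) : Prop :=
  Nonempty Γ.Half ∧ Γ.vtx ⊔ Γ.edg = ⊤ ∧
    ∀ e ∈ Γ.edges, Γ.vtx ⊔ Γ.edgesOn {h | Quotient.mk Γ.edg h ≠ e} = ⊤

open Classical in
/-- The first homology (with rational coefficients) of the graph: the flows along the internal edges
that are conserved at every vertex; `f h` is the flow leaving the vertex through `h`. -/
noncomputable def cycleSpace (Γ : Diagram F) : Submodule ℚ (Γ.Half → ℚ) where
  carrier := {f | (∀ h, h ∉ Γ.internal → f h = 0) ∧ (∀ h k, h ≠ k → Γ.edg h k → f h + f k = 0) ∧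
    ∀ v ∈ Γ.vertices, ∑ h : Γ.Half with Quotient.mk Γ.vtx h = v, f h = 0}
  zero_mem' := by simp
  add_mem' := by
    rintro f g ⟨h1, h2, h3⟩ ⟨h1', h2', h3'⟩
    refine ⟨fun h hh => by simp [h1 h hh, h1' h hh], fun h k hk e => ?_, fun v hv => ?_⟩
    · have := h2 h k hk e
      have := h2' h k hk e
      simp only [Pi.add_apply]
      linarith
    · simp only [Pi.add_apply, Finset.sum_add_distrib, h3 v hv, h3' v hv, add_zero]
  smul_mem' := by
    rintro c f ⟨h1, h2, h3⟩
    refine ⟨fun h hh => by simp [h1 h hh], fun h k hk e => ?_, fun v hv => ?_⟩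
    · have := h2 h k hk e
      simp only [Pi.smul_apply, smul_eq_mul, ← mul_add, this, mul_zero]
    · simp only [Pi.smul_apply, ← Finset.smul_sum, h3 v hv, smul_zero]

/-- The first Betti number. -/
noncomputable def betti (Γ : Diagram F) : ℕ := Module.finrank ℚ Γ.cycleSpace

/-- A set of internal edges, given as the set of its half-edges. Such a set is the same as a subgraph
without isolated vertices; its vertices are those incident to the chosen edges, and the remaining
half-edges at these vertices are its external legs. -/
def IsSubgraph (Γ : Diagram F) (S : Finset Γ.Half) : Prop :=
  S ⊆ Γ.internal ∧ ∀ h ∈ S, ∀ k, Γ.edg h k → k ∈ S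

/-- The equivalence relation whose classes are the connected components of the diagram that has all
the vertices of `Γ`, but only the edges in `S`. -/
def merged (Γ : Diagram F) (S : Finset Γ.Half) : Setoid Γ.Half := Γ.vtx ⊔ Γ.edgesOn ↑S

open Classical in
/-- The connected components of the subgraph `S`. -/
noncomputable def components (Γ : Diagram F) (S : Finset Γ.Half) : Finset (Quotient (Γ.merged S)) :=
  S.image (Quotient.mk (Γ.merged S))

/-- A connected component of the subgraph `S`, as a diagram of its own. -/
noncomputable def component (Γ : Diagram F) (S : Finset Γ.Half) (c : Quotient (Γ.merged S)) :
    Diagram F where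
  Half := {h : Γ.Half // Quotient.mk (Γ.merged S) h = c}
  fin := Fintype.ofFinite _
  vtx := Γ.vtx.comap Subtype.val
  edg := (Γ.edgesOn ↑S).comap Subtype.val
  field h := Γ.field h.1

open Classical in
/-- The vertices of the subgraph `S`. -/
noncomputable def subVertices (Γ : Diagram F) (S : Finset Γ.Half) : Finset (Quotient Γ.vtx) :=
  S.image (Quotient.mk Γ.vtx)

open Classical in
/-- The edges of the subgraph `S`. -/
noncomputable def subEdges (Γ : Diagram F) (S : Finset Γ.Half) : Finset (Quotient Γ.edg) :=
  S.image (Quotient.mk Γ.edg)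

/-- The diagram is or contains a self-loop (rose): it has a subgraph with exactly one vertex and at
least one edge. -/
def HasSelfLoop (Γ : Diagram F) : Prop :=
  ∃ S, Γ.IsSubgraph S ∧ (Γ.subVertices S).card = 1 ∧ 1 ≤ (Γ.subEdges S).card

/-- `h` is an external leg of a connected component of the subgraph `S` whose residue is an edge
residue of `Q`. -/
def IsPropagatorLeg (Q : LocalQFT F) (Γ : Diagram F) (S : Finset Γ.Half) (h : Γ.Half) : Prop :=
  h ∉ S ∧ Quotient.mk (Γ.merged S) h ∈ Γ.components S ∧
    (Γ.component S (Quotient.mk (Γ.merged S) h)).residue ∈ Q.edgeRes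

/-- The equivalence relation that joins the two external legs of each connected component of the
subgraph `S` whose residue is an edge residue. -/
def propagatorLink (Q : LocalQFT F) (Γ : Diagram F) (S : Finset Γ.Half) : Setoid Γ.Half where
  r h k := h = k ∨ (Γ.IsPropagatorLeg Q S h ∧ Γ.IsPropagatorLeg Q S k ∧ Γ.merged S h k)
  iseqv :=
    { refl := fun _ => Or.inl rfl
      symm := by
        rintro h k (rfl | ⟨hh, hk, e⟩)
        · exact Or.inl rfl
        · exact Or.inr ⟨hk, hh, (Γ.merged S).symm e⟩
      trans := by
        rintro h k l (rfl | ⟨hh, hk, e⟩) (rfl | ⟨_, hl, e'⟩)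
        · exact Or.inl rfl
        · exact Or.inr ⟨‹_›, hl, e'⟩
        · exact Or.inr ⟨hh, hk, e⟩
        · exact Or.inr ⟨hh, hl, (Γ.merged S).trans e e'⟩ }

/-- The quotient `Γ / S` for a proper subgraph `S`: each connected component is shrunken to its
residue. If the residue is not an edge residue, this is a vertex, carrying the external legs of the
component. If it is an edge residue, the component is replaced by an edge, i.e. the two edges of `Γ`
ending in the component are joined to a single edge. -/
noncomputable def contract (Q : LocalQFT F) (Γ : Diagram F) (S : Finset Γ.Half) : Diagram F where
  Half := {h : Γ.Half // h ∉ S ∧ ¬ Γ.IsPropagatorLeg Q S h}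
  fin := Fintype.ofFinite _
  vtx := (Γ.merged S).comap Subtype.val
  edg := (Γ.edg ⊔ Γ.propagatorLink Q S).comap Subtype.val
  field h := Γ.field h.1

open Classical in
/-- The non-empty proper subgraphs of `Γ` whose connected components all belong to `A`. -/
noncomputable def properSubgraphs (Γ : Diagram F) (A : Set (Diagram F)) : Finset (Finset Γ.Half) :=
  Finset.univ.filter fun S => Γ.IsSubgraph S ∧ S ≠ ∅ ∧ S ≠ Γ.internal ∧
    ∀ c ∈ Γ.components S, Γ.component S c ∈ A

/-- A component of a proper subgraph has fewer internal half-edges than the graph. -/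
theorem card_internal_component_lt (Γ : Diagram F) {A : Set (Diagram F)} {S : Finset Γ.Half}
    (hS : S ∈ Γ.properSubgraphs A) (c : Quotient (Γ.merged S)) :
    (Γ.component S c).internal.card < Γ.internal.card := by
  classical
  simp only [properSubgraphs, Finset.mem_filter, Finset.mem_univ, true_and] at hS
  obtain ⟨⟨h1, -⟩, -, h3, -⟩ := hS
  refine lt_of_le_of_lt ?_ (Finset.card_lt_card (Finset.ssubset_iff_subset_ne.2 ⟨h1, h3⟩))
  refine Finset.card_le_card_of_injOn Subtype.val (fun x hx => ?_) Subtype.val_injective.injOn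
  simp only [internal, Finset.coe_filter, Finset.mem_univ, true_and, Set.mem_ofPred_eq] at hx
  obtain ⟨k, hk, e⟩ := hx
  rcases e with e | ⟨hm, -, -⟩
  · exact absurd (Subtype.ext e).symm hk
  · exact hm

end Diagram

namespace LocalQFT

variable {F : Type u} (Q : LocalQFT F)

/-- The connected Feynman graphs of `Q`: the 1PI diagrams with vertices and edges from the residue
set, with at least one internal edge, and with at least one external leg. -/
def graphs : Set (Diagram F) :=
  {Γ | (∀ v ∈ Γ.vertices, Γ.fieldsAt Γ.vtx v ∈ Q.vertexRes) ∧
    (∀ h k l, Γ.edg h k → Γ.edg h l → h = k ∨ h = l ∨ k = l) ∧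
    (∀ e ∈ Γ.edges, Γ.fieldsAt Γ.edg e ∈ Q.edgeRes) ∧
    Γ.IsOnePI ∧ Γ.internal ≠ ∅ ∧ Γ.residue ≠ 0}

/-- The superficial degree of divergence. -/
noncomputable def degree (Γ : Diagram F) : ℤ :=
  (Q.dim : ℤ) * Γ.betti + ∑ v ∈ Γ.vertices, (Q.weight (Γ.fieldsAt Γ.vtx v) : ℤ)
    - ∑ e ∈ Γ.edges, (Q.weight (Γ.fieldsAt Γ.edg e) : ℤ)

/-- The superficially divergent connected Feynman graphs. -/
def divergent : Set (Diagram F) := {Γ ∈ Q.graphs | 0 ≤ Q.degree Γ}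

/-- The superficially divergent connected Feynman graphs with residue in the residue set. -/
def divergentRes : Set (Diagram F) := {Γ ∈ Q.divergent | Γ.residue ∈ Q.residues}

/-- All superficially divergent Feynman graphs have their residue in the residue set. -/
def IsComplete : Prop := ∀ Γ ∈ Q.divergent, Γ.residue ∈ Q.residues

/-- The connected Feynman graphs which do not contain (or equal) a superficially divergent graph
whose residue is not in the residue set. -/
def restrictedGraphs : Set (Diagram F) :=
  {Γ ∈ Q.graphs | ∀ S, Γ.IsSubgraph S → ∀ c ∈ Γ.components S,
    Γ.component S c ∈ Q.divergent → (Γ.component S c).residue ∈ Q.residues}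

/-- `Q'` arises from `Q` by adding missing residues, the weight of an added residue being that of a
divergent graph with this residue, until no residue is missing. -/
structure IsCompletion (Q' : LocalQFT F) : Prop where
  conj_eq : Q'.conj = Q.conj
  dim_eq : Q'.dim = Q.dim
  vertexRes_subset : Q.vertexRes ⊆ Q'.vertexRes
  edgeRes_subset : Q.edgeRes ⊆ Q'.edgeRes
  weight_eq : ∀ r ∈ Q.residues, Q'.weight r = Q.weight r
  added : ∀ r ∈ Q'.residues, r ∉ Q.residues →
    ∃ Γ ∈ Q'.divergent, Γ.residue = r ∧ (Q'.weight r : ℤ) = Q'.degree Γ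
  complete : Q'.IsComplete

end LocalQFT

section RenormalizationAlgebra

variable {F : Type u}

/-- Isomorphism of the diagrams in a given set `G`. -/
def isoSetoid (G : Set (Diagram F)) : Setoid G where
  r Γ Γ' := Diagram.Iso Γ.1 Γ'.1
  iseqv :=
    { refl := fun Γ => Diagram.iso_equivalence.refl Γ.1
      symm := fun h => Diagram.iso_equivalence.symm h
      trans := fun h h' => Diagram.iso_equivalence.trans h h' }

/-- The rational vector space with basis the disjoint unions of diagrams in `G` (up to isomorphism),
with the disjoint union as product: the polynomial algebra on the isomorphism classes in `G`. -/
abbrev GraphAlgebra (G : Set (Diagram F)) := MvPolynomial (Quotient (isoSetoid G)) ℚ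

open Classical in
/-- A connected diagram as an element of the algebra. Diagrams outside of `G` are set to zero. -/
noncomputable def gen (G : Set (Diagram F)) (Γ : Diagram F) : GraphAlgebra G :=
  if h : Γ ∈ G then MvPolynomial.X (Quotient.mk (isoSetoid G) ⟨Γ, h⟩) else 0

/-- A subgraph as an element of the algebra: the product of its connected components. -/
noncomputable def genSub (G : Set (Diagram F)) (Γ : Diagram F) (S : Finset Γ.Half) :
    GraphAlgebra G :=
  ∏ c ∈ Γ.components S, gen G (Γ.component S c)

/-- The coproduct of a connected diagram,
`Δ Γ = 1 ⊗ Γ + Γ ⊗ 1 + ∑ γ ⊗ Γ / γ`, with the sum over the non-empty proper subgraphs `γ` of `Γ`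
all of whose connected components belong to `A`. -/
noncomputable def coproductOf (Q : LocalQFT F) (G A : Set (Diagram F)) (Γ : Diagram F) :
    GraphAlgebra G ⊗[ℚ] GraphAlgebra G :=
  1 ⊗ₜ[ℚ] gen G Γ + gen G Γ ⊗ₜ[ℚ] 1
    + ∑ S ∈ Γ.properSubgraphs A, genSub G Γ S ⊗ₜ[ℚ] gen G (Γ.contract Q S)

/-- The coproduct. (The value of `coproductOf` only depends on the isomorphism class.) -/
noncomputable def coproduct (Q : LocalQFT F) (G A : Set (Diagram F)) :
    GraphAlgebra G →ₐ[ℚ] GraphAlgebra G ⊗[ℚ] GraphAlgebra G :=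
  MvPolynomial.aeval fun c => coproductOf Q G A c.out.1

/-- The coidentity: it is one on the empty graph and zero on every other product of graphs. -/
noncomputable def coidentity (G : Set (Diagram F)) : GraphAlgebra G →ₐ[ℚ] ℚ :=
  MvPolynomial.aeval fun _ => 0

/-- The antipode of a connected diagram, recursively `S Γ = - Γ - ∑ S γ * (Γ / γ)`, with the sum as
in the coproduct. -/
noncomputable def antipodeOf (Q : LocalQFT F) (G A : Set (Diagram F)) (Γ : Diagram F) :
    GraphAlgebra G :=
  - gen G Γ - ∑ S : {S // S ∈ Γ.properSubgraphs A},
    (∏ c ∈ Γ.components S.1, antipodeOf Q G A (Γ.component S.1 c)) * gen G (Γ.contract Q S.1)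
  termination_by Γ.internal.card
  decreasing_by exact Γ.card_internal_component_lt S.2 c

/-- The antipode. (The value of `antipodeOf` only depends on the isomorphism class.) -/
noncomputable def antipode (Q : LocalQFT F) (G A : Set (Diagram F)) :
    GraphAlgebra G →ₐ[ℚ] GraphAlgebra G :=
  MvPolynomial.aeval fun c => antipodeOf Q G A c.out.1

/-- The ideal generated by all graphs in `G` which are or contain a self-loop. -/
noncomputable def selfLoopIdeal (G : Set (Diagram F)) : Ideal (GraphAlgebra G) :=
  Ideal.span {x | ∃ Γ ∈ G, Γ.HasSelfLoop ∧ x = gen G Γ}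

end RenormalizationAlgebra

/-- Hopf ideals, with respect to a coproduct `Δ`, a coidentity `ε` and an antipode `S` on `H`:
`Δ I ⊆ I ⊗ H + H ⊗ I`, `ε I = 0` and `S I ⊆ I`. -/
structure IsHopfIdeal {H : Type*} [CommRing H] [Algebra ℚ H] (Δ : H →ₐ[ℚ] H ⊗[ℚ] H)
    (ε : H →ₐ[ℚ] ℚ) (S : H →ₐ[ℚ] H) (I : Ideal H) : Prop where
  coproduct_mem : ∀ x ∈ I, Δ x ∈
    LinearMap.range (TensorProduct.map (I.restrictScalars ℚ).subtype (LinearMap.id : H →ₗ[ℚ] H)) ⊔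
    LinearMap.range (TensorProduct.map (LinearMap.id : H →ₗ[ℚ] H) (I.restrictScalars ℚ).subtype)
  coidentity_eq : ∀ x ∈ I, ε x = 0
  antipode_mem : ∀ x ∈ I, S x ∈ I

/-!
A diagram of a local QFT is or contains a rose iff it has a tadpole edge: an internal edge `{h, k}`
both of whose half-edges sit at the same vertex
(`LocalQFT.hasSelfLoop_iff`). Let `Γ` be a Feynman graph with such an edge, and let `S` be a subgraph.

* If the edge belongs to `S`, it is a tadpole edge of a connected component of `S`
  (`Diagram.tadpole_component`).
* Otherwise it survives as a tadpole edge of `Γ / S` (`Diagram.tadpole_contract`). The only danger is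
  that `h` and `k` disappear when a component of `S` is replaced by an edge. Then this component has
  exactly the external legs `h` and `k`, which are joined to each other, so the component together
  with the edge `{h, k}` is all of the connected graph `Γ`, and `Γ` has no external legs, contrary to
  the definition of a Feynman graph.

Hence each term `γ ⊗ Γ / γ` of the coproduct has a factor in the ideal, and the antipode follows by
induction on the number of internal half-edges. This works for any sets `G` of generators and `A` of
admissible components which consist of Feynman graphs, so the four cases are instances of
`isHopfIdeal_selfLoopIdeal`.
-/

/-! ### Tadpole edges -/

namespace Diagram

variable {F : Type u} {Γ Γ' : Diagram F}

/-- Some edge has both its half-edges `h ≠ k` at the same vertex. -/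
def HasTadpole (Γ : Diagram F) : Prop := ∃ h k, h ≠ k ∧ Γ.edg h k ∧ Γ.vtx h k

theorem mem_internal {h : Γ.Half} : h ∈ Γ.internal ↔ ∃ k, k ≠ h ∧ Γ.edg h k := by
  simp [internal]

theorem mem_components {S : Finset Γ.Half} {h : Γ.Half} (hS : h ∈ S) :
    Quotient.mk (Γ.merged S) h ∈ Γ.components S := by
  classical
  exact Finset.mem_image_of_mem _ hS

theorem HasSelfLoop.hasTadpole (hΓ : Γ.HasSelfLoop) : Γ.HasTadpole := by
  classical
  obtain ⟨S, ⟨hint, hcl⟩, hv, he⟩ := hΓ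
  obtain ⟨e, he⟩ := Finset.card_pos.1 he
  obtain ⟨h, hS, -⟩ := Finset.mem_image.1 he
  obtain ⟨k, hk, hhk⟩ := mem_internal.1 (hint hS)
  exact ⟨h, k, hk.symm, hhk, Quotient.exact (Finset.card_le_one.1 hv.le _
    (Finset.mem_image_of_mem _ hS) _ (Finset.mem_image_of_mem _ (hcl h hS k hhk)))⟩

theorem HasTadpole.hasSelfLoop (hedg : ∀ h k l, Γ.edg h k → Γ.edg h l → h = k ∨ h = l ∨ k = l)
    (hΓ : Γ.HasTadpole) : Γ.HasSelfLoop := by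
  classical
  obtain ⟨h, k, hne, he, hv⟩ := hΓ
  refine ⟨{h, k}, ⟨?_, ?_⟩, ?_, ?_⟩
  · intro x hx
    rcases Finset.mem_insert.1 hx with rfl | hx
    · exact mem_internal.2 ⟨k, hne.symm, he⟩
    · rw [Finset.mem_singleton.1 hx]
      exact mem_internal.2 ⟨h, hne, Γ.edg.symm he⟩
  · intro x hx y hxy
    have hy : Γ.edg h y := by
      rcases Finset.mem_insert.1 hx with rfl | hx
      · exact hxy
      · rw [Finset.mem_singleton.1 hx] at hxy
        exact Γ.edg.trans he hxy
    rcases hedg h k y he hy with h1 | h1 | h1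
    · exact absurd h1 hne
    · simp [← h1]
    · simp [← h1]
  · have : Quotient.mk Γ.vtx k = Quotient.mk Γ.vtx h := Quotient.sound (Γ.vtx.symm hv)
    simp [subVertices, Finset.image_insert, this]
  · exact Finset.card_pos.2 ⟨_, Finset.mem_image_of_mem _ (Finset.mem_insert_self h {k})⟩

theorem HasTadpole.of_iso (hiso : Iso Γ Γ') (hΓ : Γ.HasTadpole) : Γ'.HasTadpole := by
  obtain ⟨e, hv, he, -⟩ := hiso
  obtain ⟨h, k, hne, h1, h2⟩ := hΓ
  exact ⟨e h, e k, e.injective.ne hne, (he h k).1 h1, (hv h k).1 h2⟩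

end Diagram

theorem LocalQFT.hasSelfLoop_iff {F : Type u} (Q : LocalQFT F) {Γ : Diagram F}
    (hΓ : Γ ∈ Q.graphs) : Γ.HasSelfLoop ↔ Γ.HasTadpole :=
  ⟨fun h => h.hasTadpole, fun h => h.hasSelfLoop hΓ.2.1⟩

/-! ### Tadpole edges in subgraphs and contractions -/

namespace Diagram

variable {F : Type u} {Γ : Diagram F}

theorem tadpole_component {S : Finset Γ.Half} {h k : Γ.Half} (hh : h ∈ S) (hk : k ∈ S)
    (hne : h ≠ k) (he : Γ.edg h k) (hv : Γ.vtx h k) :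
    (Γ.component S (Quotient.mk (Γ.merged S) h)).HasTadpole := by
  have hm : Γ.merged S h k := (le_sup_left : Γ.vtx ≤ Γ.merged S) hv
  exact ⟨⟨h, rfl⟩, ⟨k, Quotient.sound ((Γ.merged S).symm hm)⟩, fun H => hne (congrArg Subtype.val H),
    Or.inr ⟨hh, hk, he⟩, hv⟩

theorem notMem_internal_component {S : Finset Γ.Half} {c : Quotient (Γ.merged S)}
    {x : (Γ.component S c).Half} (hx : x.1 ∉ S) : x ∉ (Γ.component S c).internal := by
  rw [mem_internal]
  rintro ⟨k, hk, e | ⟨hm, -, -⟩⟩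
  · exact hk (Subtype.ext e.symm)
  · exact hx hm

theorem eq_of_residue_mem_edgeRes (Q : LocalQFT F) (hres : Γ.residue ∈ Q.edgeRes) {x y z : Γ.Half}
    (hx : x ∉ Γ.internal) (hy : y ∉ Γ.internal) (hz : z ∉ Γ.internal) :
    x = y ∨ x = z ∨ y = z := by
  classical
  obtain ⟨a, ha⟩ := Q.edge_pair _ hres
  have hcard : (Finset.univ.filter fun h => h ∉ Γ.internal).card = 2 := by
    have := congrArg Multiset.card ha
    rw [residue, Multiset.card_map, Multiset.card_pair, ← Finset.card_def] at this
    convert this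
  by_contra! H
  have h3 : 2 < (Finset.univ.filter fun h => h ∉ Γ.internal).card :=
    Finset.two_lt_card.2 ⟨x, by simpa using hx, y, by simpa using hy, z, by simpa using hz, H⟩
  omega

/-- A component of a subgraph which shrinks to an edge has only two external legs. -/
theorem eq_or_eq_of_component_residue_mem_edgeRes (Q : LocalQFT F) {S : Finset Γ.Half}
    {h k x : Γ.Half} (hres : (Γ.component S (Quotient.mk (Γ.merged S) h)).residue ∈ Q.edgeRes)
    (hh : h ∉ S) (hk : k ∉ S) (hx : x ∉ S) (hne : h ≠ k) (hhk : Γ.merged S h k)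
    (hhx : Γ.merged S h x) : x = h ∨ x = k := by
  have sound {y : Γ.Half} (hy : Γ.merged S h y) :
      Quotient.mk (Γ.merged S) y = Quotient.mk (Γ.merged S) h :=
    Quotient.sound ((Γ.merged S).symm hy)
  rcases eq_of_residue_mem_edgeRes Q hres (x := ⟨h, rfl⟩) (y := ⟨k, sound hhk⟩)
      (z := ⟨x, sound hhx⟩) (notMem_internal_component hh) (notMem_internal_component hk)
      (notMem_internal_component hx) with E | E | E
  · exact absurd (congrArg Subtype.val E) hne
  · exact Or.inl (congrArg Subtype.val E).symm
  · exact Or.inr (congrArg Subtype.val E).symm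

/-- In a Feynman graph, the two external legs of a component which shrinks to an edge are not joined
to each other at a common vertex: otherwise the graph would have no external legs. -/
theorem not_isPropagatorLeg_of_tadpole (Q : LocalQFT F) (hΓ : Γ ∈ Q.graphs) {S : Finset Γ.Half}
    (hS : Γ.IsSubgraph S) {h k : Γ.Half} (hk : k ∉ S) (hne : h ≠ k) (he : Γ.edg h k)
    (hv : Γ.vtx h k) : ¬ Γ.IsPropagatorLeg Q S h := by
  classical
  rintro ⟨hh, -, hres⟩
  obtain ⟨-, hedg, -, ⟨-, hconn, -⟩, -, hext⟩ := hΓ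
  have hvm : Γ.vtx ≤ Γ.merged S := le_sup_left
  have legs (x : Γ.Half) (hx : x ∉ S) (hhx : Γ.merged S h x) : x = h ∨ x = k :=
    eq_or_eq_of_component_residue_mem_edgeRes Q hres hh hk hx hne (hvm hv) hhx
  have step (x y : Γ.Half) (hxy : Γ.edg x y) (hhx : Γ.merged S h x) : Γ.merged S h y := by
    by_cases hx : x ∈ S
    · refine (Γ.merged S).trans hhx ((le_sup_right : Γ.edgesOn ↑S ≤ Γ.merged S) ?_)
      exact Or.inr ⟨hx, hS.2 x hx y hxy, hxy⟩
    · have hy : Γ.edg h y := by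
        rcases legs x hx hhx with rfl | rfl
        · exact hxy
        · exact Γ.edg.trans he hxy
      rcases hedg h k y he hy with h1 | h1 | h1
      · exact absurd h1 hne
      · exact h1 ▸ (Γ.merged S).refl h
      · exact h1 ▸ hvm hv
  -- The component of `h` is closed under passing along vertices and edges, hence is everything.
  have all (x : Γ.Half) : Γ.merged S h x := by
    let s : Setoid Γ.Half := Setoid.comap (fun x => Γ.merged S h x) ⊥
    have hs : Γ.vtx ⊔ Γ.edg ≤ s := sup_le
      (fun {x y} hxy => propext ⟨fun H => (Γ.merged S).trans H (hvm hxy),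
        fun H => (Γ.merged S).trans H ((Γ.merged S).symm (hvm hxy))⟩)
      (fun {x y} hxy => propext ⟨step x y hxy, step y x (Γ.edg.symm hxy)⟩)
    rw [hconn] at hs
    have hx : Γ.merged S h h = Γ.merged S h x := hs (trivial : (⊤ : Setoid Γ.Half) h x)
    exact hx ▸ (Γ.merged S).refl h
  refine hext ?_
  have : (Finset.univ.filter fun x => x ∉ Γ.internal) = ∅ := by
    refine Finset.filter_eq_empty_iff.2 fun x _ hx => hx ?_
    rcases legs x (fun H => hx (hS.1 H)) (all x) with rfl | rfl
    · exact mem_internal.2 ⟨k, hne.symm, he⟩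
    · exact mem_internal.2 ⟨h, hne, Γ.edg.symm he⟩
  simp [residue, this]

theorem tadpole_contract (Q : LocalQFT F) (hΓ : Γ ∈ Q.graphs) {S : Finset Γ.Half}
    (hS : Γ.IsSubgraph S) {h k : Γ.Half} (hh : h ∉ S) (hk : k ∉ S) (hne : h ≠ k)
    (he : Γ.edg h k) (hv : Γ.vtx h k) : (Γ.contract Q S).HasTadpole := by
  refine ⟨⟨h, hh, not_isPropagatorLeg_of_tadpole Q hΓ hS hk hne he hv⟩,
    ⟨k, hk, not_isPropagatorLeg_of_tadpole Q hΓ hS hh hne.symm (Γ.edg.symm he) (Γ.vtx.symm hv)⟩,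
    fun H => hne (congrArg Subtype.val H), ?_, ?_⟩
  · exact (le_sup_left : Γ.edg ≤ Γ.edg ⊔ Γ.propagatorLink Q S) he
  · exact (le_sup_left : Γ.vtx ≤ Γ.merged S) hv

theorem HasTadpole.component_or_contract (Q : LocalQFT F) (hΓ : Γ ∈ Q.graphs) (ht : Γ.HasTadpole)
    {S : Finset Γ.Half} (hS : Γ.IsSubgraph S) :
    (∃ c ∈ Γ.components S, (Γ.component S c).HasTadpole) ∨ (Γ.contract Q S).HasTadpole := by
  obtain ⟨h, k, hne, he, hv⟩ := ht
  by_cases hh : h ∈ S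
  · exact Or.inl ⟨_, mem_components hh, tadpole_component hh (hS.2 h hh k he) hne he hv⟩
  · exact Or.inr (tadpole_contract Q hΓ hS hh (fun hk => hh (hS.2 k hk h (Γ.edg.symm he))) hne he hv)

theorem mem_properSubgraphs {A : Set (Diagram F)} {S : Finset Γ.Half} :
    S ∈ Γ.properSubgraphs A ↔ Γ.IsSubgraph S ∧ S ≠ ∅ ∧ S ≠ Γ.internal ∧
      ∀ c ∈ Γ.components S, Γ.component S c ∈ A := by
  simp [properSubgraphs]

end Diagram

/-! ### The ideal generated by self-loops -/

section RenormalizationAlgebra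

variable {F : Type u} (Q : LocalQFT F) {G A : Set (Diagram F)}

/-- Outside of `G` this holds because `gen G` vanishes there, so it applies to all components and
contractions. -/
theorem gen_mem_selfLoopIdeal (hG : G ⊆ Q.graphs) {Γ : Diagram F} (ht : Γ.HasTadpole) :
    gen G Γ ∈ selfLoopIdeal G := by
  by_cases hΓ : Γ ∈ G
  · exact Ideal.subset_span ⟨Γ, hΓ, (Q.hasSelfLoop_iff (hG hΓ)).2 ht, rfl⟩
  · simp [gen, hΓ]

theorem coproductOf_mem (hG : G ⊆ Q.graphs) {Γ : Diagram F} (hΓ : Γ ∈ Q.graphs)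
    (ht : Γ.HasTadpole) :
    coproductOf Q G A Γ ∈
      (selfLoopIdeal G).map (Algebra.TensorProduct.includeLeft :
        GraphAlgebra G →ₐ[ℚ] GraphAlgebra G ⊗[ℚ] GraphAlgebra G) ⊔
      (selfLoopIdeal G).map (Algebra.TensorProduct.includeRight :
        GraphAlgebra G →ₐ[ℚ] GraphAlgebra G ⊗[ℚ] GraphAlgebra G) := by
  set J := (selfLoopIdeal G).map (Algebra.TensorProduct.includeLeft :
        GraphAlgebra G →ₐ[ℚ] GraphAlgebra G ⊗[ℚ] GraphAlgebra G) ⊔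
      (selfLoopIdeal G).map (Algebra.TensorProduct.includeRight :
        GraphAlgebra G →ₐ[ℚ] GraphAlgebra G ⊗[ℚ] GraphAlgebra G)
  have left (x y : GraphAlgebra G) (hx : x ∈ selfLoopIdeal G) : x ⊗ₜ[ℚ] y ∈ J := by
    have : x ⊗ₜ[ℚ] y = (1 ⊗ₜ[ℚ] y) * (x ⊗ₜ[ℚ] 1) := by simp
    rw [this]
    exact J.mul_mem_left _ (Ideal.mem_sup_left (Ideal.mem_map_of_mem _ hx))
  have right (x y : GraphAlgebra G) (hy : y ∈ selfLoopIdeal G) : x ⊗ₜ[ℚ] y ∈ J := by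
    have : x ⊗ₜ[ℚ] y = (x ⊗ₜ[ℚ] 1) * (1 ⊗ₜ[ℚ] y) := by simp
    rw [this]
    exact J.mul_mem_left _ (Ideal.mem_sup_right (Ideal.mem_map_of_mem _ hy))
  have hgen := gen_mem_selfLoopIdeal Q hG ht
  refine J.add_mem (J.add_mem (right _ _ hgen) (left _ _ hgen)) (J.sum_mem fun S hS => ?_)
  rcases ht.component_or_contract Q hΓ (Diagram.mem_properSubgraphs.1 hS).1 with ⟨c, hc, h⟩ | h
  · exact left _ _ (Ideal.prod_mem _ hc (gen_mem_selfLoopIdeal Q hG h))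
  · exact right _ _ (gen_mem_selfLoopIdeal Q hG h)

theorem antipodeOf_mem (hG : G ⊆ Q.graphs) (hA : A ⊆ Q.graphs) (Γ : Diagram F)
    (hΓ : Γ ∈ Q.graphs) (ht : Γ.HasTadpole) : antipodeOf Q G A Γ ∈ selfLoopIdeal G := by
  rw [antipodeOf]
  refine sub_mem (neg_mem (gen_mem_selfLoopIdeal Q hG ht)) (sum_mem fun S _ => ?_)
  obtain ⟨hS, -, -, hcA⟩ := Diagram.mem_properSubgraphs.1 S.2
  rcases ht.component_or_contract Q hΓ hS with ⟨c, hc, h⟩ | h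
  · exact Ideal.mul_mem_right _ _ (Ideal.prod_mem _ hc
      (antipodeOf_mem hG hA (Γ.component S.1 c) (hA (hcA c hc)) h))
  · exact Ideal.mul_mem_left _ _ (gen_mem_selfLoopIdeal Q hG h)
  termination_by Γ.internal.card
  decreasing_by exact Γ.card_internal_component_lt S.2 c

/-- The tadpole is found on the representative `c.out` of the isomorphism class, on which the
structure maps are evaluated. -/
theorem exists_rep_of_hasSelfLoop {Γ : Diagram F} (hΓ : Γ ∈ G) (ht : Γ.HasSelfLoop) :
    ∃ c : Quotient (isoSetoid G), gen G Γ = MvPolynomial.X c ∧ c.out.1.HasTadpole := by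
  refine ⟨Quotient.mk _ ⟨Γ, hΓ⟩, by simp [gen, hΓ], ht.hasTadpole.of_iso ?_⟩
  exact Diagram.iso_equivalence.symm
    (Quotient.exact (Quotient.out_eq (Quotient.mk (isoSetoid G) ⟨Γ, hΓ⟩)))

theorem selfLoopIdeal_le {K : Ideal (GraphAlgebra G)}
    (h : ∀ c : Quotient (isoSetoid G), c.out.1.HasTadpole → MvPolynomial.X c ∈ K) :
    selfLoopIdeal G ≤ K := by
  refine Ideal.span_le.2 ?_
  rintro _ ⟨Γ, hΓ, ht, rfl⟩
  obtain ⟨c, hc, htc⟩ := exists_rep_of_hasSelfLoop hΓ ht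
  exact hc ▸ h c htc

theorem isHopfIdeal_selfLoopIdeal (hG : G ⊆ Q.graphs) (hA : A ⊆ Q.graphs) :
    IsHopfIdeal (coproduct Q G A) (coidentity G) (antipode Q G A) (selfLoopIdeal G) where
  coproduct_mem x hx := by
    have key := selfLoopIdeal_le (K := Ideal.comap (coproduct Q G A) _) (fun c hc => by
      rw [Ideal.mem_comap, coproduct, MvPolynomial.aeval_X]
      exact coproductOf_mem Q (A := A) hG (hG c.out.2) hc) hx
    rw [Ideal.mem_comap, Submodule.mem_sup] at key
    obtain ⟨a, ha, b, hb, hab⟩ := key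
    rw [← hab]
    exact Submodule.add_mem_sup ((Ideal.map_includeLeft_eq (selfLoopIdeal G)).le ha)
      ((Ideal.map_includeRight_eq (selfLoopIdeal G)).le hb)
  coidentity_eq x hx := selfLoopIdeal_le (K := RingHom.ker (coidentity G))
    (fun c _ => by rw [RingHom.mem_ker, coidentity, MvPolynomial.aeval_X]) hx
  antipode_mem x hx := selfLoopIdeal_le (K := Ideal.comap (antipode Q G A) (selfLoopIdeal G))
    (fun c hc => by
      rw [Ideal.mem_comap, antipode, MvPolynomial.aeval_X]
      exact antipodeOf_mem Q hG hA _ (hG c.out.2) hc) hx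

end RenormalizationAlgebra

theorem mainTheorem3 {F : Type u} (Q : LocalQFT F) :
    (Q.IsComplete →
      IsHopfIdeal (coproduct Q Q.graphs Q.divergent) (coidentity Q.graphs)
        (antipode Q Q.graphs Q.divergent) (selfLoopIdeal Q.graphs)) ∧
    IsHopfIdeal (coproduct Q Q.restrictedGraphs Q.divergent) (coidentity Q.restrictedGraphs)
      (antipode Q Q.restrictedGraphs Q.divergent) (selfLoopIdeal Q.restrictedGraphs) ∧
    IsHopfIdeal (coproduct Q Q.graphs Q.divergentRes) (coidentity Q.graphs)
      (antipode Q Q.graphs Q.divergentRes) (selfLoopIdeal Q.graphs) ∧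
    ∀ Q' : LocalQFT F, Q.IsCompletion Q' →
      IsHopfIdeal (coproduct Q' Q'.graphs Q'.divergent) (coidentity Q'.graphs)
        (antipode Q' Q'.graphs Q'.divergent) (selfLoopIdeal Q'.graphs) :=
  ⟨fun _ => isHopfIdeal_selfLoopIdeal Q subset_rfl fun _ h => h.1,
    isHopfIdeal_selfLoopIdeal Q (fun _ h => h.1) fun _ h => h.1,
    isHopfIdeal_selfLoopIdeal Q subset_rfl fun _ h => h.1.1,
    fun Q' _ => isHopfIdeal_selfLoopIdeal Q' subset_rfl fun _ h => h.1⟩
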